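/- Let $(G,\|\cdot\|)$ be a separable (real or complex) Hilbert space with its Borel $\sigma$-algebra, let $I$ be a measurable space, let $T_i:G\to G$ ($i\in I$) be maps such that the update function $\Phi:G\times I\to G$, $\Phi(x,i)=T_i(x)$, is measurable, and let $\xi$ be an $I$-valued random variable on a probability space $(\Omega,\mathcal F,\mathbb P)$. Let $p(x,A)=\mathbb P(\Phi(x,\xi)\in A)$ be the associated transition kernel, let $(\mu\mathcal P)(A)=\int_G p(x,A)\,\mu(dx)$ be the associated Markov operator on the set $\mathscr P(G)$ of Borel probability measures, and let $\operatorname{inv}\mathcal P=\{\pi\in\mathscr P(G):\pi\mathcal P=\pi\}$. Let $\mathscr P_2(G)$ be the set of $\mu\in\mathscr P(G)$ with $\int\|x-y\|^2\,\mu(dy)<\infty$ for some $x\in G$. Let $C(\mu,\nu)$ be the set of couplings of $\mu$ and $\nu$, let $W_2(\mu,\nu)=\bigl(\inf_{\gamma\in C(\mu,\nu)}\int\|x-y\|^2\,\gamma(dx,dy)\bigr)^{1/2}$, and let $C_*(\mu,\nu)$ be the set of $\gamma\in C(\mu,\nu)$ with $\int\|x-y\|^2\,\gamma(dx,dy)=W_2^2(\mu,\nu)$.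 With $d(x,y)=\|x-y\|$ put $$\psi_2(x,y,x^+,y^+)=d^2(x^+,x)+d^2(y^+,y)+d^2(x^+,y^+)+d^2(x,y)-d^2(x^+,y)-d^2(x,y^+),$$ which in a Hilbert space equals $\|(x-x^+)-(y-y^+)\|^2\ge 0$, and $$\Psi(\mu)=\inf_{\pi\in\operatorname{inv}\mathcal P}\ \inf_{\gamma\in C_*(\mu,\pi)}\Bigl(\int_{G\times G}\mathbb E\bigl[\psi_2(x,y,T_\xi x,T_\xi y)\bigr]\,\gamma(dx,dy)\Bigr)^{1/2}\in[0,\infty],$$ with $\inf\emptyset=+\infty$. Suppose that $\Phi$ is a contraction in expectation with constant $r\in[0,1)$, i.e. $\mathbb E\bigl[\|\Phi(x,\xi)-\Phi(y,\xi)\|^2\bigr]\le r^2\|x-y\|^2$ for all $x,y\in G$, and that there is $y\in G$ with $\mathbb E\bigl[\|\Phi(y,\xi)-y\|^2\bigr]<\infty$. Then the following hold. (i) There is exactly one measure $\pi\in\mathscr P_2(G)$ that is invariant for $\mathcal P$, and for all $\mu_0\in\mathscr P_2(G)$ and $n\ge 0$ we have $W_2(\mu_0\mathcal P^n,\pi)\le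 r^n\,W_2(\mu_0,\pi)$; moreover the sequence $\mu_{k}=\mu_0\mathcal P^k$ converges to $\pi$ Q-linearly with rate $r$, i.e. $W_2(\mu_{k+1},\pi)\le r\,W_2(\mu_k,\pi)$ for all $k\ge 0$. (ii) Let $\alpha=(1+r)/2\in(0,1)$. Then $\Phi$ is $\alpha$-firmly nonexpansive in expectation, i.e. for all $x,x_0\in G$ $$\mathbb E\bigl[\|\Phi(x,\xi)-\Phi(x_0,\xi)\|^2\bigr]\le\|x-x_0\|^2-\tfrac{1-\alpha}{\alpha}\,\mathbb E\bigl[\psi_2(x,x_0,\Phi(x,\xi),\Phi(x_0,\xi))\bigr],$$ and $\mathcal P$ is $\alpha$-firmly nonexpansive in measure on $\mathscr P_2(G)$, i.e. for all $\mu_1,\mu_2\in\mathscr P_2(G)$ and all $\gamma\in C_*(\mu_1,\mu_2)$ $$W_2^2(\mu_1\mathcal P,\mu_2\mathcal P)\le W_2^2(\mu_1,\mu_2)-\tfrac{1-\alpha}{\alpha}\int_{G\times G}\mathbb E\bigl[\psi_2(x,y,\Phi(x,\xi),\Phi(y,\xi))\bigr]\,\gamma(dx,dy).$$ (iii) If $q>0$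 is such that $\Psi(\mu)\ge q\,W_2(\mu\mathcal P,\mu)$ for all $\mu\in\mathscr P_2(G)$, then $\Psi$ is linearly metrically subregular for $0$ relative to $\mathscr P_2(G)$ on $\mathscr P_2(G)$ with gauge $\rho(t)=(q(1-r))^{-1}t$, i.e. $$\inf_{\nu\in\Psi^{-1}(0)\cap\mathscr P_2(G)}W_2(\mu,\nu)\le\frac{1}{q(1-r)}\,\Psi(\mu)\qquad\text{for all }\mu\in\mathscr P_2(G).$$ -/

import Mathlib

open MeasureTheory ProbabilityTheory
open scoped ENNReal

namespace RandomFunctionIteration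

section Wasserstein

variable {G : Type*} [PseudoEMetricSpace G] [MeasurableSpace G]

/-- `𝒫₂(G)`: the Borel probability measures with finite second moment about some point. -/
def P2 (G : Type*) [PseudoEMetricSpace G] [MeasurableSpace G] : Set (Measure G) :=
  {μ | IsProbabilityMeasure μ ∧ ∃ x : G, ∫⁻ y, edist x y ^ 2 ∂μ < ∞}

/-- `C(μ, ν)`: the couplings of `μ` and `ν`, i.e. the measures on `G × G` with these marginals. -/
def couplings (μ ν : Measure G) : Set (Measure (G × G)) :=
  {γ | γ.map Prod.fst = μ ∧ γ.map Prod.snd = ν}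

/-- The Wasserstein 2-distance, with values in `[0, ∞]`. -/
noncomputable def W2 (μ ν : Measure G) : ℝ≥0∞ :=
  (⨅ γ ∈ couplings μ ν, ∫⁻ z, edist z.1 z.2 ^ 2 ∂γ) ^ (1 / 2 : ℝ)

/-- `C_*(μ, ν)`: the couplings at which the Wasserstein 2-distance is attained. -/
def optimalCouplings (μ ν : Measure G) : Set (Measure (G × G)) :=
  {γ ∈ couplings μ ν | ∫⁻ z, edist z.1 z.2 ^ 2 ∂γ = W2 μ ν ^ 2}

end Wasserstein

section General

/-- Q-linear convergence of the sequence `x` to `a` with rate `c ∈ [0, 1)`, for the distance `d`. -/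
def QLinearConvergence {A : Type*} (d : A → A → ℝ≥0∞) (x : ℕ → A) (a : A) (c : ℝ) : Prop :=
  (0 ≤ c ∧ c < 1) ∧ ∀ k, d (x (k + 1)) a ≤ ENNReal.ofReal c * d (x k) a

/-- The distance `|a - b|` on `[0, ∞]` (one of the two truncated differences is zero). -/
noncomputable def absDiff (a b : ℝ≥0∞) : ℝ≥0∞ := (a - b) + (b - a)

/-- `Ψ : A → B` is metrically subregular for `y` relative to `Λ` on `U` with gauge `ρ`.
Distances take values in `[0, ∞]` and the infimum over the empty set is `∞`. -/
def MetricallySubregular {A B : Type*} (dA : A → A → ℝ≥0∞) (dB : B → B → ℝ≥0∞)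
    (Ψ : A → B) (y : B) (Λ U : Set A) (ρ : ℝ≥0∞ → ℝ≥0∞) : Prop :=
  ∀ x ∈ U ∩ Λ, ⨅ z ∈ Ψ ⁻¹' {y} ∩ Λ, dA x z ≤ ρ (dB y (Ψ x))

/-- Metric subregularity with the linear gauge `ρ(t) = κ t`, where `κ > 0`. -/
def LinearlyMetricallySubregular {A B : Type*} (dA : A → A → ℝ≥0∞) (dB : B → B → ℝ≥0∞)
    (Ψ : A → B) (y : B) (Λ U : Set A) (κ : ℝ) : Prop :=
  0 < κ ∧ MetricallySubregular dA dB Ψ y Λ U (fun t => ENNReal.ofReal κ * t)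

end General

section TransportDiscrepancy

/-- The transport discrepancy `ψ_c(x, x₀, x⁺, x₀⁺)` of a metric space. -/
noncomputable def transportDiscrepancy {G : Type*} [PseudoMetricSpace G]
    (c : ℝ) (x x₀ xp x₀p : G) : ℝ :=
  c / 2 * (dist xp x ^ 2 + dist x₀p x₀ ^ 2 + dist xp x₀p ^ 2 + dist x x₀ ^ 2
    - dist xp x₀ ^ 2 - dist x x₀p ^ 2)

/-- In an inner product space `ψ₂` is the square of a norm; in particular it is nonnegative, so
nothing is lost when its expectation is taken in `[0, ∞]` through `ENNReal.ofReal` below. -/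
theorem transportDiscrepancy_two_eq {𝕜 G : Type*} [RCLike 𝕜] [NormedAddCommGroup G]
    [InnerProductSpace 𝕜 G] (x x₀ xp x₀p : G) :
    transportDiscrepancy 2 x x₀ xp x₀p = ‖(x - xp) - (x₀ - x₀p)‖ ^ 2 := by
  let _ : InnerProductSpace ℝ G := InnerProductSpace.rclikeToReal 𝕜 G
  simp only [transportDiscrepancy, dist_eq_norm, ← real_inner_self_eq_norm_sq,
    inner_sub_left, inner_sub_right]
  rw [real_inner_comm x xp, real_inner_comm x x₀, real_inner_comm x x₀p,
    real_inner_comm xp x₀, real_inner_comm xp x₀p, real_inner_comm x₀ x₀p]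
  ring

end TransportDiscrepancy

section RandomMaps

variable {G I Ω : Type*} [MeasurableSpace I] [MeasurableSpace Ω]

/-- The update function `Φ(x, i) = T_i x`. -/
def updateFun (T : I → G → G) : G × I → G := fun z => T z.2 z.1

/-- The transition kernel `p(x, A) = ℙ(Φ(x, ξ) ∈ A)`. -/
noncomputable def transitionKernel [MeasurableSpace G] (P : Measure Ω) [IsProbabilityMeasure P]
    (T : I → G → G) (hT : Measurable (updateFun T)) (ξ : Ω → I) (hξ : Measurable ξ) :
    Kernel G G where
  toFun x := P.map (fun ω => updateFun T (x, ξ ω))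
  measurable' := by
    have h : Measurable (fun z : G × Ω => updateFun T (z.1, ξ z.2)) :=
      hT.comp (measurable_fst.prodMk (hξ.comp measurable_snd))
    refine Measure.measurable_of_measurable_coe _ fun s hs => ?_
    have h2 : ∀ x, (P.map (fun ω => updateFun T (x, ξ ω))) s
        = P (Prod.mk x ⁻¹' ((fun z : G × Ω => updateFun T (z.1, ξ z.2)) ⁻¹' s)) := fun x =>
      Measure.map_apply (h.comp measurable_prodMk_left) hs
    simp only [h2]
    exact measurable_measure_prodMk_left (h hs)

/-- The (dual) Markov operator `μ ↦ μ𝒫`, `(μ𝒫)(A) = ∫ p(x, A) μ(dx)`, of a transition kernel. -/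
noncomputable def markovOp [MeasurableSpace G] (p : Kernel G G) (μ : Measure G) : Measure G :=
  μ.bind p

/-- `inv 𝒫`: the invariant probability measures. -/
def invMeasures [MeasurableSpace G] (p : Kernel G G) : Set (Measure G) :=
  {π | IsProbabilityMeasure π ∧ markovOp p π = π}

/-- `Φ` is a contraction in expectation with constant `r`:
`𝔼 ‖Φ(x, ξ) - Φ(y, ξ)‖² ≤ r² ‖x - y‖²` for all `x, y`. -/
def ContractionInExpectation [NormedAddCommGroup G] (P : Measure Ω) (T : I → G → G) (ξ : Ω → I)
    (r : ℝ) : Prop :=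
  ∀ x y : G, ∫⁻ ω, ‖updateFun T (x, ξ ω) - updateFun T (y, ξ ω)‖ₑ ^ 2 ∂P
    ≤ ENNReal.ofReal (r ^ 2) * ‖x - y‖ₑ ^ 2

/-- `𝔼[ψ₂(x, y, T_ξ x, T_ξ y)]`, an element of `[0, ∞]`. -/
noncomputable def expectedDiscrepancy [PseudoMetricSpace G] (P : Measure Ω) (T : I → G → G)
    (ξ : Ω → I) (x y : G) : ℝ≥0∞ :=
  ∫⁻ ω, ENNReal.ofReal
    (transportDiscrepancy 2 x y (updateFun T (x, ξ ω)) (updateFun T (y, ξ ω))) ∂P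

/-- `Φ` is almost `α`-firmly nonexpansive in expectation on `G` with violation `ε`.
The discrepancy term `(1 - α)/α 𝔼[ψ₂]` stands on the left, so that no subtraction
of possibly infinite quantities occurs. -/
def AlmostFNEInExpectation [PseudoMetricSpace G] (P : Measure Ω) (T : I → G → G) (ξ : Ω → I)
    (α ε : ℝ) : Prop :=
  (0 < α ∧ α < 1) ∧ (0 ≤ ε ∧ ε < 1) ∧ ∀ x₀ x : G,
    ∫⁻ ω, edist (updateFun T (x, ξ ω)) (updateFun T (x₀, ξ ω)) ^ 2 ∂P
      + ENNReal.ofReal ((1 - α) / α) * expectedDiscrepancy P T ξ x x₀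
      ≤ ENNReal.ofReal (1 + ε) * edist x x₀ ^ 2

/-- `α`-firmly nonexpansive in expectation: the violation is zero. -/
def FNEInExpectation [PseudoMetricSpace G] (P : Measure Ω) (T : I → G → G) (ξ : Ω → I)
    (α : ℝ) : Prop :=
  AlmostFNEInExpectation P T ξ α 0

variable [PseudoMetricSpace G] [MeasurableSpace G]

/-- The Markov operator is almost `α`-firmly nonexpansive in measure on the set `S` of measures,
with violation `ε`; again the discrepancy term stands on the left. -/
def AlmostFNEInMeasureOn (S : Set (Measure G)) (P : Measure Ω) [IsProbabilityMeasure P]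
    (T : I → G → G) (hT : Measurable (updateFun T)) (ξ : Ω → I) (hξ : Measurable ξ)
    (α ε : ℝ) : Prop :=
  (0 < α ∧ α < 1) ∧ (0 ≤ ε ∧ ε < 1) ∧ ∀ μ₁ ∈ S, ∀ μ₂ ∈ S, ∀ γ ∈ optimalCouplings μ₁ μ₂,
    W2 (markovOp (transitionKernel P T hT ξ hξ) μ₁) (markovOp (transitionKernel P T hT ξ hξ) μ₂) ^ 2
      + ENNReal.ofReal ((1 - α) / α) * ∫⁻ z, expectedDiscrepancy P T ξ z.1 z.2 ∂γ
      ≤ ENNReal.ofReal (1 + ε) * W2 μ₁ μ₂ ^ 2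

/-- `α`-firmly nonexpansive in measure on `S`: the violation is zero. -/
def FNEInMeasureOn (S : Set (Measure G)) (P : Measure Ω) [IsProbabilityMeasure P]
    (T : I → G → G) (hT : Measurable (updateFun T)) (ξ : Ω → I) (hξ : Measurable ξ)
    (α : ℝ) : Prop :=
  AlmostFNEInMeasureOn S P T hT ξ hξ α 0

/-- The Markov transport discrepancy
`Ψ(μ) = inf_{π ∈ inv 𝒫} inf_{γ ∈ C_*(μ, π)} (∫ 𝔼[ψ₂(x, y, T_ξ x, T_ξ y)] γ(dx, dy))^{1/2}`,
which is `∞` if there is no such `π` or `γ`. -/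
noncomputable def markovTransportDiscrepancy (P : Measure Ω) [IsProbabilityMeasure P]
    (T : I → G → G) (hT : Measurable (updateFun T)) (ξ : Ω → I) (hξ : Measurable ξ)
    (μ : Measure G) : ℝ≥0∞ :=
  ⨅ π ∈ invMeasures (transitionKernel P T hT ξ hξ), ⨅ γ ∈ optimalCouplings μ π,
    (∫⁻ z, expectedDiscrepancy P T ξ z.1 z.2 ∂γ) ^ (1 / 2 : ℝ)

end RandomMaps

end RandomFunctionIteration

open RandomFunctionIteration

/-! Everything rests on synchronous coupling: driving both coordinates of a coupling of `μ` and `ν`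
by the same `ξ` couples `μ𝒫` and `ν𝒫`, so an expectation bound valid at each pair of points
integrates to a bound on `W2`. In particular `𝒫` is an `r`-contraction for `W2` (`W2_markovOp_le`),
which gives the rate and, as `W2` is finite on `P2 G` and separates probability measures,
uniqueness.

Existence needs no completeness of the Wasserstein space. For i.i.d. copies of `ξ`, the backward
iterates started at `y` have the laws `δ_y 𝒫ⁿ`, and their successive `L²` distances decay like `rⁿ`.
They converge in `L²`, and the law of the limit is invariant (`exists_invariant_measure`).

For firm nonexpansiveness, Minkowski gives `𝔼[ψ₂] ≤ (1 + r)² ‖x - y‖²`, and `α = (1 + r)/2` makes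
`r² + ((1 - α)/α)(1 + r)² = 1`.

For subregularity, `Ψ(π) = 0`, and `W2 μ π ≤ W2 μ (μ𝒫) + r W2 μ π`; the last term is absorbed on the
left and the first is at most `Ψ(μ)/q`. -/

namespace RandomFunctionIteration

/-! ### Minkowski's inequality and square roots in `[0, ∞]`. -/

section LintegralMinkowski

variable {S : Type*} [MeasurableSpace S]

/-- Minkowski's inequality in `L²` for `[0, ∞]`-valued functions. -/
theorem lintegral_sq_le_of_le_add {μ : Measure S} {f g h : S → ℝ≥0∞}
    (hf : AEMeasurable f μ) (hg : AEMeasurable g μ) (hh : ∀ s, h s ≤ f s + g s) :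
    (∫⁻ s, h s ^ 2 ∂μ) ^ (1 / 2 : ℝ)
      ≤ (∫⁻ s, f s ^ 2 ∂μ) ^ (1 / 2 : ℝ) + (∫⁻ s, g s ^ 2 ∂μ) ^ (1 / 2 : ℝ) := by
  have key := ENNReal.lintegral_Lp_add_le hf hg (p := 2) one_le_two
  simp only [ENNReal.rpow_two, Pi.add_apply] at key
  refine le_trans ?_ key
  gcongr with s
  exact hh s

theorem sq_rpow_half (a : ℝ≥0∞) : (a ^ 2) ^ (1 / 2 : ℝ) = a := by
  rw [← ENNReal.rpow_two, ← ENNReal.rpow_mul]; norm_num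

theorem rpow_half_sq (a : ℝ≥0∞) : (a ^ (1 / 2 : ℝ)) ^ 2 = a := by
  rw [← ENNReal.rpow_two, ← ENNReal.rpow_mul]; norm_num

theorem eLpNorm_two_eq {E : Type*} [NormedAddCommGroup E] (μ : Measure S) (f : S → E) :
    eLpNorm f 2 μ = (∫⁻ s, ‖f s‖ₑ ^ 2 ∂μ) ^ (1 / 2 : ℝ) := by
  rw [eLpNorm_eq_lintegral_rpow_enorm_toReal (by norm_num) (by norm_num)]
  simp

end LintegralMinkowski

/-! ### Couplings and the Wasserstein distance. -/

section Couplings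

variable {G : Type*} [MeasurableSpace G] {μ ν : Measure G}

theorem isProbabilityMeasure_of_mem_couplings [IsProbabilityMeasure μ] {γ : Measure (G × G)}
    (hγ : γ ∈ couplings μ ν) : IsProbabilityMeasure γ := by
  constructor
  have h : γ.map Prod.fst Set.univ = 1 := by rw [hγ.1]; exact measure_univ
  rwa [Measure.map_apply measurable_fst MeasurableSet.univ, Set.preimage_univ] at h

theorem map_prodMk_mem_couplings {S : Type*} [MeasurableSpace S] (Q : Measure S) {f g : S → G}
    (hf : Measurable f) (hg : Measurable g) :
    Q.map (fun s => (f s, g s)) ∈ couplings (Q.map f) (Q.map g) := by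
  constructor
  · rw [Measure.map_map measurable_fst (hf.prodMk hg)]; rfl
  · rw [Measure.map_map measurable_snd (hf.prodMk hg)]; rfl

theorem map_swap_mem_couplings {γ : Measure (G × G)} (hγ : γ ∈ couplings μ ν) :
    γ.map Prod.swap ∈ couplings ν μ := by
  constructor
  · rw [Measure.map_map measurable_fst measurable_swap]; exact hγ.2
  · rw [Measure.map_map measurable_snd measurable_swap]; exact hγ.1

theorem prod_mem_couplings [IsProbabilityMeasure μ] [IsProbabilityMeasure ν] :
    μ.prod ν ∈ couplings μ ν := by
  constructor
  · exact (Measure.fst_prod (μ := μ) (ν := ν))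
  · exact (Measure.snd_prod (μ := μ) (ν := ν))

end Couplings

section WassersteinBasic

variable {G : Type*} [PseudoEMetricSpace G] [MeasurableSpace G] {μ ν : Measure G}

theorem W2_sq (μ ν : Measure G) :
    W2 μ ν ^ 2 = ⨅ γ ∈ couplings μ ν, ∫⁻ z, edist z.1 z.2 ^ 2 ∂γ := rpow_half_sq _

theorem W2_sq_le {γ : Measure (G × G)} (hγ : γ ∈ couplings μ ν) :
    W2 μ ν ^ 2 ≤ ∫⁻ z, edist z.1 z.2 ^ 2 ∂γ := by
  rw [W2_sq]; exact iInf₂_le γ hγ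

theorem W2_eq_iInf (μ ν : Measure G) :
    W2 μ ν = ⨅ γ ∈ couplings μ ν, (∫⁻ z, edist z.1 z.2 ^ 2 ∂γ) ^ (1 / 2 : ℝ) := by
  simp only [W2, iInf_subtype']
  exact OrderIso.map_iInf (ENNReal.orderIsoRpow (1 / 2) (by norm_num)) _

theorem W2_le {γ : Measure (G × G)} (hγ : γ ∈ couplings μ ν) :
    W2 μ ν ≤ (∫⁻ z, edist z.1 z.2 ^ 2 ∂γ) ^ (1 / 2 : ℝ) := by
  rw [W2_eq_iInf]; exact iInf₂_le γ hγ

end WassersteinBasic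

section WassersteinMetric

variable {G : Type*} [PseudoEMetricSpace G] [SecondCountableTopology G] [MeasurableSpace G]
  [BorelSpace G] {μ ν ρ : Measure G}

theorem measurable_edist_sq : Measurable fun z : G × G => edist z.1 z.2 ^ 2 :=
  (measurable_fst.edist measurable_snd).pow_const 2

theorem W2_map_le {S : Type*} [MeasurableSpace S] (Q : Measure S) {f g : S → G}
    (hf : Measurable f) (hg : Measurable g) :
    W2 (Q.map f) (Q.map g) ≤ (∫⁻ s, edist (f s) (g s) ^ 2 ∂Q) ^ (1 / 2 : ℝ) := by
  refine (W2_le (map_prodMk_mem_couplings Q hf hg)).trans_eq ?_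
  rw [lintegral_map measurable_edist_sq (hf.prodMk hg)]

theorem W2_symm_le (μ ν : Measure G) : W2 ν μ ≤ W2 μ ν := by
  rw [W2_eq_iInf μ ν]
  refine le_iInf₂ fun γ hγ => (W2_le (map_swap_mem_couplings hγ)).trans_eq ?_
  rw [lintegral_map measurable_edist_sq measurable_swap]
  simp only [Prod.fst_swap, Prod.snd_swap, edist_comm]

theorem W2_comm (μ ν : Measure G) : W2 μ ν = W2 ν μ :=
  le_antisymm (W2_symm_le ν μ) (W2_symm_le μ ν)

theorem map_diag_mem_optimalCouplings (μ : Measure G) :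
    μ.map (fun x => (x, x)) ∈ optimalCouplings μ μ := by
  have hc : μ.map (fun x => (x, x)) ∈ couplings μ μ := by
    simpa using map_prodMk_mem_couplings μ measurable_id measurable_id
  have h0 : ∫⁻ z, edist z.1 z.2 ^ 2 ∂(μ.map fun x => (x, x)) = 0 := by
    rw [lintegral_map measurable_edist_sq (by fun_prop)]
    simp
  refine ⟨hc, ?_⟩
  have := W2_sq_le hc
  rw [h0] at this ⊢
  exact (nonpos_iff_eq_zero.1 this).symm

/-- No optimal coupling is needed: Markov's inequality bounds `μ F` minus the `ν`-mass of the
`ε`-thickening of `F` by the cost of any coupling over `ε²`. Taking the infimum over couplings and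
then `ε → 0` gives the claim. -/
theorem measure_closed_le_of_W2_eq_zero [IsProbabilityMeasure μ] [IsProbabilityMeasure ν]
    (h : W2 μ ν = 0) {F : Set G} (hF : IsClosed F) : μ F ≤ ν F := by
  have hlim := tendsto_measure_thickening_of_isClosed (μ := ν)
    ⟨1, one_pos, measure_ne_top _ _⟩ hF
  refine ge_of_tendsto hlim ?_
  filter_upwards [self_mem_nhdsWithin] with ε hε
  have hε' : (0 : ℝ) < ε := hε
  have hc : (ENNReal.ofReal ε) ^ 2 ≠ 0 := by simp [hε']
  have key : ∀ γ ∈ couplings μ ν, ENNReal.ofReal ε ^ 2 * (μ F - ν (Metric.thickening ε F))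
      ≤ ∫⁻ z, edist z.1 z.2 ^ 2 ∂γ := by
    intro γ hγ
    refine le_trans ?_ (mul_meas_ge_le_lintegral measurable_edist_sq (ENNReal.ofReal ε ^ 2))
    gcongr
    rw [tsub_le_iff_left, ← hγ.1, ← hγ.2, Measure.map_apply measurable_fst hF.measurableSet,
      Measure.map_apply measurable_snd Metric.isOpen_thickening.measurableSet]
    refine le_trans (measure_mono fun z hz => ?_) (measure_union_le _ _)
    by_cases hz' : edist z.1 z.2 < ENNReal.ofReal ε
    · left
      rw [Set.mem_preimage, Metric.mem_thickening_iff_exists_edist_lt]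
      exact ⟨z.1, hz, by rwa [edist_comm]⟩
    · right
      have := not_lt.1 hz'
      simp only [Set.mem_ofPred_eq]
      gcongr
  have h2 : ENNReal.ofReal ε ^ 2 * (μ F - ν (Metric.thickening ε F)) ≤ 0 := by
    refine (le_iInf₂ key).trans ?_
    rw [← W2_sq, h]; simp
  have h3 := (mul_eq_zero.1 (nonpos_iff_eq_zero.1 h2)).resolve_left hc
  exact tsub_eq_zero_iff_le.1 h3

theorem eq_of_W2_eq_zero [IsProbabilityMeasure μ] [IsProbabilityMeasure ν]
    (h : W2 μ ν = 0) : μ = ν := by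
  refine ext_of_generate_finite {s : Set G | IsClosed s} ?_ isPiSystem_isClosed
    (fun s hs => le_antisymm (measure_closed_le_of_W2_eq_zero h hs)
      (measure_closed_le_of_W2_eq_zero (by rwa [W2_comm]) hs)) (by simp)
  rw [← borel_eq_generateFrom_isClosed]
  exact BorelSpace.measurable_eq

/-- The gluing lemma gives the triangle inequality of `W2`. -/
theorem W2_triangle [StandardBorelSpace G] [IsProbabilityMeasure μ] [IsProbabilityMeasure ν] :
    W2 μ ρ ≤ W2 μ ν + W2 ν ρ := by
  rw [W2_eq_iInf μ ν, W2_eq_iInf ν ρ]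
  simp only [ENNReal.iInf_add, ENNReal.add_iInf]
  refine le_iInf₂ fun γ₂ h₂ => le_iInf₂ fun γ₁ h₁ => ?_
  have := isProbabilityMeasure_of_mem_couplings h₁
  have := isProbabilityMeasure_of_mem_couplings h₂
  have : Nonempty G := by
    by_contra hne
    rw [not_nonempty_iff] at hne
    exact IsProbabilityMeasure.ne_zero μ (Measure.eq_zero_of_isEmpty μ)
  -- Gluing: `γ₂` is disintegrated over its first marginal `ν`, and a third point is drawn from `κ`
  -- given the second point of `γ₁`. The outer coordinates of `η` then couple `μ` and `ρ`.
  set κ := γ₂.condKernel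
  have hκ : γ₂ = ν.compProd κ := by
    conv_lhs => rw [← γ₂.disintegrate κ]
    congr 1
    exact h₂.1
  set η : Measure ((G × G) × G) := γ₁.compProd (κ.comap Prod.snd measurable_snd)
  have hη₁ : η.map Prod.fst = γ₁ := Measure.fst_compProd _ _
  have hm : Measurable fun z : (G × G) × G => (z.1.2, z.2) := by fun_prop
  have hη₂ : η.map (fun z => (z.1.2, z.2)) = γ₂ := by
    rw [hκ, ← h₁.2]
    refine Measure.ext_of_lintegral _ fun f hf => ?_
    have hfm : Measurable fun z : (G × G) × G => f (z.1.2, z.2) := hf.comp hm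
    rw [lintegral_map hf hm, Measure.lintegral_compProd hfm,
      Measure.lintegral_compProd hf, lintegral_map ?_ measurable_snd]
    · rfl
    · exact hf.lintegral_kernel_prod_right'
  have e₁ : ∫⁻ z, edist z.1 z.2 ^ 2 ∂γ₁ = ∫⁻ w, edist w.1.1 w.1.2 ^ 2 ∂η := by
    rw [← hη₁, lintegral_map measurable_edist_sq measurable_fst]
  have e₂ : ∫⁻ z, edist z.1 z.2 ^ 2 ∂γ₂ = ∫⁻ w, edist w.1.2 w.2 ^ 2 ∂η := by
    rw [← hη₂, lintegral_map measurable_edist_sq hm]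
  have hc : W2 μ ρ ≤ (∫⁻ w, edist w.1.1 w.2 ^ 2 ∂η) ^ (1 / 2 : ℝ) := by
    have h1 : η.map (fun w => w.1.1) = μ := by
      rw [← h₁.1, ← hη₁, Measure.map_map measurable_fst measurable_fst]; rfl
    have h2 : η.map (fun w => w.2) = ρ := by
      rw [← h₂.2, ← hη₂, Measure.map_map measurable_snd hm]; rfl
    have := W2_map_le η (f := fun w => w.1.1) (g := fun w => w.2) (by fun_prop) (by fun_prop)
    rwa [h1, h2] at this
  rw [e₁, e₂]
  refine hc.trans (lintegral_sq_le_of_le_add ?_ ?_ fun w => edist_triangle _ _ _)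
  · exact ((measurable_fst.comp measurable_fst).edist
      (measurable_snd.comp measurable_fst)).aemeasurable
  · exact ((measurable_snd.comp measurable_fst).edist measurable_snd).aemeasurable

end WassersteinMetric

/-! ### Finiteness of the Wasserstein distance on measures with second moments. -/

section FiniteMoment

variable {G : Type*} [PseudoMetricSpace G] [SecondCountableTopology G] [MeasurableSpace G]
  [BorelSpace G] {μ ν : Measure G}

theorem lintegral_edist_sq_lt_top_of_mem_P2 (hμ : μ ∈ P2 G) (x : G) :
    ∫⁻ z, edist x z ^ 2 ∂μ < ∞ := by
  obtain ⟨_, y, hy⟩ := hμ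
  have hym : Measurable fun z : G => edist y z := measurable_const.edist measurable_id
  have h := lintegral_sq_le_of_le_add (μ := μ) (f := fun _ => edist x y)
    aemeasurable_const hym.aemeasurable fun z => edist_triangle x y z
  have hlt := h.trans_lt (b := _) (c := ∞) (ENNReal.add_lt_top.2
    ⟨ENNReal.rpow_lt_top_of_nonneg (by norm_num) (by simp [edist_ne_top]),
      ENNReal.rpow_lt_top_of_nonneg (by norm_num) hy.ne⟩)
  rwa [ENNReal.rpow_lt_top_iff_of_pos (by norm_num)] at hlt

theorem W2_lt_top (hμ : μ ∈ P2 G) (hν : ν ∈ P2 G) : W2 μ ν < ∞ := by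
  have := hμ.1
  have := hν.1
  obtain ⟨x, hx⟩ := hμ.2
  have hy := lintegral_edist_sq_lt_top_of_mem_P2 hν x
  have hxm : Measurable fun z : G => edist x z := measurable_const.edist measurable_id
  have h := lintegral_sq_le_of_le_add (μ := μ.prod ν) (f := fun z : G × G => edist x z.1)
    (g := fun z => edist x z.2) (hxm.comp measurable_fst).aemeasurable
    (hxm.comp measurable_snd).aemeasurable fun z => edist_triangle_left z.1 z.2 x
  refine (W2_le prod_mem_couplings).trans_lt (h.trans_lt (ENNReal.add_lt_top.2 ⟨?_, ?_⟩))
  · refine ENNReal.rpow_lt_top_of_nonneg (by norm_num) (ne_of_lt ?_)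
    rwa [← (measurePreserving_fst (μ := μ) (ν := ν)).lintegral_comp (hxm.pow_const 2)] at hx
  · refine ENNReal.rpow_lt_top_of_nonneg (by norm_num) (ne_of_lt ?_)
    rwa [← (measurePreserving_snd (μ := μ) (ν := ν)).lintegral_comp (hxm.pow_const 2)] at hy

end FiniteMoment

/-! ### The Markov operator and its contraction property. -/

section MarkovOperator

variable {G I Ω : Type*} [MeasurableSpace G] [MeasurableSpace I] [MeasurableSpace Ω]
  {P : Measure Ω} {T : I → G → G} {ξ : Ω → I}

theorem measurable_updateFun_prod {S : Type*} [MeasurableSpace S] {f : S → G}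
    (hT : Measurable (updateFun T)) (hξ : Measurable ξ) (hf : Measurable f) :
    Measurable fun z : S × Ω => updateFun T (f z.1, ξ z.2) :=
  hT.comp ((hf.comp measurable_fst).prodMk (hξ.comp measurable_snd))

theorem measurable_updateFun_right (hT : Measurable (updateFun T)) (hξ : Measurable ξ) (x : G) :
    Measurable fun ω => updateFun T (x, ξ ω) :=
  hT.comp (measurable_const.prodMk hξ)

variable [IsProbabilityMeasure P] (hT : Measurable (updateFun T)) (hξ : Measurable ξ)

instance isMarkovKernel_transitionKernel : IsMarkovKernel (transitionKernel P T hT ξ hξ) :=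
  ⟨fun x => Measure.isProbabilityMeasure_map (measurable_updateFun_right hT hξ x).aemeasurable⟩

theorem isProbabilityMeasure_markovOp (p : Kernel G G) [IsMarkovKernel p] (μ : Measure G)
    [IsProbabilityMeasure μ] : IsProbabilityMeasure (markovOp p μ) := by
  unfold markovOp; infer_instance

/-- `μ𝒫` is the law of `Φ(X, ξ)` for `X` with law `μ` independent of `ξ`. -/
theorem map_updateFun_prod {S : Type*} [MeasurableSpace S] (Q : Measure S) [SFinite Q]
    {f : S → G} (hf : Measurable f) :
    (Q.prod P).map (fun z => updateFun T (f z.1, ξ z.2))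
      = markovOp (transitionKernel P T hT ξ hξ) (Q.map f) := by
  have hm := measurable_updateFun_prod hT hξ hf
  ext s hs
  rw [Measure.map_apply hm hs, Measure.prod_apply (hm hs), markovOp,
    Measure.bind_apply hs (Kernel.aemeasurable _), lintegral_map (Kernel.measurable_coe _ hs) hf]
  refine lintegral_congr fun a => ?_
  change _ = (P.map (fun ω => updateFun T (f a, ξ ω))) s
  rw [Measure.map_apply (measurable_updateFun_right hT hξ _) hs]
  rfl

end MarkovOperator

section Contraction

variable {G I Ω : Type*} [PseudoEMetricSpace G] [SecondCountableTopology G] [MeasurableSpace G]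
  [BorelSpace G] [MeasurableSpace I] [MeasurableSpace Ω]
  {P : Measure Ω} {T : I → G → G} {ξ : Ω → I} {μ ν : Measure G}

theorem measurable_edist_updateFun_sq (hT : Measurable (updateFun T)) (hξ : Measurable ξ)
    {S : Type*} [MeasurableSpace S] {f g : S → G} (hf : Measurable f) (hg : Measurable g) :
    Measurable fun z : S × Ω =>
      edist (updateFun T (f z.1, ξ z.2)) (updateFun T (g z.1, ξ z.2)) ^ 2 :=
  ((measurable_updateFun_prod hT hξ hf).edist (measurable_updateFun_prod hT hξ hg)).pow_const 2

variable [IsProbabilityMeasure P] (hT : Measurable (updateFun T)) (hξ : Measurable ξ)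

/-- Driving a coupling of `μ` and `ν` by the same `ξ` gives a coupling of `μ𝒫` and `ν𝒫`. -/
theorem W2_markovOp_sq_le [IsProbabilityMeasure μ] {γ : Measure (G × G)}
    (hγ : γ ∈ couplings μ ν) :
    W2 (markovOp (transitionKernel P T hT ξ hξ) μ) (markovOp (transitionKernel P T hT ξ hξ) ν) ^ 2
      ≤ ∫⁻ z, ∫⁻ ω, edist (updateFun T (z.1, ξ ω)) (updateFun T (z.2, ξ ω)) ^ 2 ∂P ∂γ := by
  have := isProbabilityMeasure_of_mem_couplings hγ
  have h := W2_map_le (γ.prod P) (measurable_updateFun_prod hT hξ measurable_fst)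
    (measurable_updateFun_prod hT hξ measurable_snd)
  rw [map_updateFun_prod hT hξ γ measurable_fst, map_updateFun_prod hT hξ γ measurable_snd,
    hγ.1, hγ.2, lintegral_prod _ (measurable_edist_updateFun_sq hT hξ
      measurable_fst measurable_snd).aemeasurable] at h
  calc _ ≤ _ := pow_le_pow_left' h 2
    _ = _ := rpow_half_sq _

theorem W2_markovOp_le [IsProbabilityMeasure μ] [IsProbabilityMeasure ν] {r : ℝ} (hr : 0 ≤ r)
    (h : ∀ x y : G, ∫⁻ ω, edist (updateFun T (x, ξ ω)) (updateFun T (y, ξ ω)) ^ 2 ∂P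
      ≤ ENNReal.ofReal (r ^ 2) * edist x y ^ 2) :
    W2 (markovOp (transitionKernel P T hT ξ hξ) μ) (markovOp (transitionKernel P T hT ξ hξ) ν)
      ≤ ENNReal.ofReal r * W2 μ ν := by
  have key : ∀ γ ∈ couplings μ ν,
      W2 (markovOp (transitionKernel P T hT ξ hξ) μ) (markovOp (transitionKernel P T hT ξ hξ) ν)
        ≤ ENNReal.ofReal r * (∫⁻ z, edist z.1 z.2 ^ 2 ∂γ) ^ (1 / 2 : ℝ) := by
    intro γ hγ
    rw [← ENNReal.pow_le_pow_left_iff two_ne_zero, mul_pow, rpow_half_sq,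
      ← ENNReal.ofReal_pow hr, ← lintegral_const_mul _ measurable_edist_sq]
    exact (W2_markovOp_sq_le hT hξ hγ).trans (lintegral_mono fun z => h z.1 z.2)
  rcases hr.eq_or_lt with rfl | hr'
  -- For `r = 0` the factor does not pass through the infimum without further argument, but the
  -- bound from any single coupling is already `0`, since `0 * ∞ = 0`.
  · simpa using key _ prod_mem_couplings
  · rw [W2_eq_iInf μ ν]
    have h0 : ENNReal.ofReal r ≠ 0 := by simpa using hr'
    simp only [ENNReal.mul_iInf_of_ne h0 ENNReal.ofReal_ne_top]
    exact le_iInf₂ key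

end Contraction

/-! ### Invariance of i.i.d. sequences under prepending an independent copy. -/

section StationarySequence

variable {Ω : Type*} [MeasurableSpace Ω]

/-- Prepend a value to a sequence. -/
def seqCons (z : (ℕ → Ω) × Ω) : ℕ → Ω := fun n => Nat.casesOn n z.2 z.1

theorem measurable_seqCons : Measurable (seqCons (Ω := Ω)) := by
  refine measurable_pi_lambda _ fun n => ?_
  cases n with
  | zero => exact measurable_snd
  | succ n => exact (measurable_pi_apply n).comp measurable_fst

theorem map_seqCons_infinitePi (P : Measure Ω) [IsProbabilityMeasure P] :
    ((Measure.infinitePi fun _ : ℕ => P).prod P).map seqCons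
      = Measure.infinitePi fun _ : ℕ => P := by
  classical
  refine Measure.eq_infinitePi _ fun s t ht => ?_
  -- Padding with `Set.univ` turns the cylinder into a box over the initial segment `range (N + 1)`,
  -- from which index `0`, the prepended value, splits off.
  obtain ⟨N, hN⟩ := s.exists_nat_subset_range
  set u : ℕ → Set Ω := fun i => if i ∈ s then t i else Set.univ with hu
  have hum : ∀ i, MeasurableSet (u i) := fun i => by
    simp only [hu]; split_ifs <;> simp [ht]
  have hpre : seqCons ⁻¹' (s : Set ℕ).pi t
      = ((Finset.range N : Set ℕ).pi fun i => u (i + 1)) ×ˢ u 0 := by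
    ext z
    simp only [Set.mem_preimage, Set.mem_pi, Finset.mem_coe, Set.mem_prod, Finset.mem_range, hu]
    constructor
    · refine fun h => ⟨fun i _ => ?_, ?_⟩
      · split_ifs with hi
        · exact h (i + 1) hi
        · trivial
      · split_ifs with hi
        · exact h 0 hi
        · trivial
    · rintro ⟨h1, h2⟩ i hi
      cases i with
      | zero => rwa [if_pos hi] at h2
      | succ i =>
        have := h1 i (by have := Finset.mem_range.1 (hN hi); omega)
        rwa [if_pos hi] at this
  have hms : MeasurableSet ((s : Set ℕ).pi t) :=
    MeasurableSet.pi s.countable_toSet fun i _ => ht i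
  rw [Measure.map_apply measurable_seqCons hms, hpre, Measure.prod_prod,
    Measure.infinitePi_pi _ fun i _ => hum _]
  rw [← Finset.prod_range_succ' (fun i => P (u i)) N]
  have hs : s ⊆ Finset.range (N + 1) := hN.trans (Finset.range_mono N.le_succ)
  rw [← Finset.prod_subset hs (f := fun i => P (u i))]
  · exact Finset.prod_congr rfl fun i hi => by simp [hu, hi]
  · intro i _ hi
    simp [hu, hi]

end StationarySequence

/-! ### Existence of an invariant measure by backward iteration. -/

section BackwardIteration

variable {G I Ω : Type*}

/-- The backward iterates `T_{ξ(ω₀)} ⋯ T_{ξ(ω_{n-1})} y`. -/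
def backwardIterate (T : I → G → G) (ξ : Ω → I) (y : G) : ℕ → (ℕ → Ω) → G
  | 0 => fun _ => y
  | n + 1 => fun ω => updateFun T (backwardIterate T ξ y n fun k => ω (k + 1), ξ (ω 0))

theorem backwardIterate_succ_seqCons (T : I → G → G) (ξ : Ω → I) (y : G) (n : ℕ)
    (z : (ℕ → Ω) × Ω) : backwardIterate T ξ y (n + 1) (seqCons z)
      = updateFun T (backwardIterate T ξ y n z.1, ξ z.2) := rfl

variable [MeasurableSpace I] [MeasurableSpace Ω] {T : I → G → G} {ξ : Ω → I}

theorem measurable_backwardIterate [MeasurableSpace G] (hT : Measurable (updateFun T))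
    (hξ : Measurable ξ) (y : G) (n : ℕ) : Measurable (backwardIterate T ξ y n) := by
  induction n with
  | zero => exact measurable_const
  | succ n ih =>
    refine hT.comp ((ih.comp ?_).prodMk (hξ.comp (measurable_pi_apply 0)))
    exact measurable_pi_lambda _ fun k => measurable_pi_apply (k + 1)

variable {P : Measure Ω} [IsProbabilityMeasure P]

/-- The inner iterate depends only on the shifted sequence, which is independent of `ω 0`; the new
outermost map therefore acts on its law as `𝒫`. -/
theorem map_backwardIterate_succ [MeasurableSpace G] (hT : Measurable (updateFun T))
    (hξ : Measurable ξ) (y : G) (n : ℕ) :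
    (Measure.infinitePi fun _ : ℕ => P).map (backwardIterate T ξ y (n + 1))
      = markovOp (transitionKernel P T hT ξ hξ)
        ((Measure.infinitePi fun _ : ℕ => P).map (backwardIterate T ξ y n)) := by
  rw [← map_updateFun_prod hT hξ _ (measurable_backwardIterate hT hξ y n)]
  conv_lhs => rw [← map_seqCons_infinitePi P]
  rw [Measure.map_map (measurable_backwardIterate hT hξ y (n + 1)) measurable_seqCons]
  rfl

variable [NormedAddCommGroup G] [SecondCountableTopology G] [MeasurableSpace G] [BorelSpace G]

/-- Consecutive backward iterates share their outermost map, so each induction step peels it off at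
the cost of a factor `c`. Forward iterates of the same sequence differ in their innermost argument
only after a shift, and need not converge pathwise. -/
theorem lintegral_backwardIterate_sub_le (hT : Measurable (updateFun T)) (hξ : Measurable ξ)
    {c : ℝ≥0∞} (h : ∀ x y : G, ∫⁻ ω, edist (updateFun T (x, ξ ω)) (updateFun T (y, ξ ω)) ^ 2 ∂P
      ≤ c * edist x y ^ 2) (y : G) (n : ℕ) :
    ∫⁻ ω, edist (backwardIterate T ξ y n ω) (backwardIterate T ξ y (n + 1) ω) ^ 2
        ∂(Measure.infinitePi fun _ : ℕ => P)
      ≤ c ^ n * ∫⁻ ω, edist y (updateFun T (y, ξ ω)) ^ 2 ∂P := by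
  have hX := measurable_backwardIterate hT hξ y
  induction n with
  | zero =>
    refine le_of_eq ?_
    rw [pow_zero, one_mul, ← (measurePreserving_eval_infinitePi (fun _ : ℕ => P) 0).lintegral_comp
      ((measurable_const.edist (measurable_updateFun_right hT hξ y)).pow_const 2)]
    rfl
  | succ n ih =>
    conv_lhs => rw [← map_seqCons_infinitePi P]
    rw [lintegral_map (((hX _).edist (hX _)).pow_const 2) measurable_seqCons]
    simp only [backwardIterate_succ_seqCons]
    rw [lintegral_prod _ (measurable_edist_updateFun_sq hT hξ (hX _) (hX _)).aemeasurable]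
    refine (lintegral_mono fun ω => h _ _).trans ?_
    rw [lintegral_const_mul _ (((hX _).edist (hX _)).pow_const 2), pow_succ', mul_assoc]
    gcongr

theorem exists_invariant_measure [CompleteSpace G] (hT : Measurable (updateFun T))
    (hξ : Measurable ξ) {r : ℝ} (hr₀ : 0 ≤ r) (hr₁ : r < 1)
    (h : ∀ x y : G, ∫⁻ ω, edist (updateFun T (x, ξ ω)) (updateFun T (y, ξ ω)) ^ 2 ∂P
      ≤ ENNReal.ofReal (r ^ 2) * edist x y ^ 2) (y : G)
    (hy : ∫⁻ ω, edist y (updateFun T (y, ξ ω)) ^ 2 ∂P < ∞) :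
    ∃ π ∈ invMeasures (transitionKernel P T hT ξ hξ), π ∈ P2 G := by
  set Q : Measure (ℕ → Ω) := Measure.infinitePi fun _ : ℕ => P
  set X := backwardIterate T ξ y
  have hX : ∀ n, Measurable (X n) := measurable_backwardIterate hT hξ y
  set C : ℝ≥0∞ := (∫⁻ ω, edist y (updateFun T (y, ξ ω)) ^ 2 ∂P) ^ (1 / 2 : ℝ) with hC
  have hCtop : C ≠ ∞ := ENNReal.rpow_ne_top_of_nonneg (by norm_num) hy.ne
  have hd : ∀ n, eLpNorm (X n - X (n + 1)) 2 Q ≤ C * ENNReal.ofReal r ^ n := fun n => by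
    rw [← ENNReal.pow_le_pow_left_iff two_ne_zero, eLpNorm_two_eq, rpow_half_sq, mul_pow, hC,
      rpow_half_sq, ← pow_mul, mul_comm n 2, pow_mul, ← ENNReal.ofReal_pow hr₀, mul_comm]
    simpa only [edist_eq_enorm_sub, Pi.sub_apply] using lintegral_backwardIterate_sub_le hT hξ h y n
  -- Square integrability starts from the constant `y` and propagates through the increments bounded
  -- in `hd`.
  have hL : ∀ n, MemLp (X n) 2 Q := fun n => by
    induction n with
    | zero => exact memLp_const y
    | succ n ih =>
      have hdn : MemLp (X n - X (n + 1)) 2 Q :=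
        ⟨((hX n).sub (hX (n + 1))).aestronglyMeasurable,
          (hd n).trans_lt (ENNReal.mul_lt_top hCtop.lt_top
            (ENNReal.pow_lt_top ENNReal.ofReal_lt_top))⟩
      simpa using ih.sub hdn
  obtain ⟨F, hF⟩ := cauchySeq_tendsto_of_complete
    (cauchySeq_of_edist_le_geometric (f := fun n => (hL n).toLp (X n)) (ENNReal.ofReal r) C
      (by simpa using hr₁) hCtop fun n => by rw [Lp.edist_toLp_toLp]; exact hd n)
  have hFm : Measurable F := (Lp.stronglyMeasurable F).measurable
  have hlim : Filter.Tendsto (fun n => W2 (Q.map (X n)) (Q.map F)) Filter.atTop (nhds 0) := by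
    rw [tendsto_iff_edist_tendsto_0] at hF
    refine tendsto_of_tendsto_of_tendsto_of_le_of_le tendsto_const_nhds hF (fun _ => zero_le)
      fun n => (W2_map_le Q (hX n) hFm).trans_eq ?_
    rw [Lp.edist_def, eLpNorm_two_eq]
    congr 1
    refine lintegral_congr_ae ?_
    filter_upwards [(hL n).coeFn_toLp] with ω hω
    rw [Pi.sub_apply, hω, edist_eq_enorm_sub]
  have hprob : ∀ {f : (ℕ → Ω) → G}, Measurable f → IsProbabilityMeasure (Q.map f) :=
    fun hf => Measure.isProbabilityMeasure_map hf.aemeasurable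
  have := hprob hFm
  have := fun n => hprob (hX n)
  have := isProbabilityMeasure_markovOp (transitionKernel P T hT ξ hξ) (Q.map F)
  refine ⟨Q.map F, ⟨hprob hFm, ?_⟩, hprob hFm, 0, ?_⟩
  · refine eq_of_W2_eq_zero (nonpos_iff_eq_zero.1 ?_)
    -- Passing through the law of `X (n + 1)`, which is the image under `𝒫` of the law of `X n`,
    -- bounds the distance from the limit law to its own image by this null sequence.
    have hlim' : Filter.Tendsto (fun n => ENNReal.ofReal r * W2 (Q.map (X n)) (Q.map F)
        + W2 (Q.map (X (n + 1))) (Q.map F)) Filter.atTop (nhds 0) := by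
      simpa using (ENNReal.Tendsto.const_mul hlim (Or.inr ENNReal.ofReal_ne_top)).add
        (hlim.comp (Filter.tendsto_add_atTop_nat 1))
    refine ge_of_tendsto' hlim' fun n => ?_
    refine (W2_triangle (ν := Q.map (X (n + 1)))).trans ?_
    gcongr
    rw [map_backwardIterate_succ hT hξ, W2_comm (Q.map (X n))]
    exact (W2_markovOp_le hT hξ hr₀ h).trans_eq rfl
  · have h0 : Measurable fun x : G => edist 0 x := measurable_const.edist measurable_id
    rw [lintegral_map (h0.pow_const 2) hFm]
    have := (Lp.memLp F).2
    rw [eLpNorm_two_eq, ENNReal.rpow_lt_top_iff_of_pos (by norm_num)] at this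
    simpa [edist_eq_enorm_sub] using this

end BackwardIteration

/-! ### Transport discrepancy and firm nonexpansiveness. -/

section Discrepancy

variable {G I Ω : Type*} [NormedAddCommGroup G] [MeasurableSpace Ω]
  {P : Measure Ω} {T : I → G → G} {ξ : Ω → I}

theorem expectedDiscrepancy_eq (𝕜 : Type*) [RCLike 𝕜] [InnerProductSpace 𝕜 G]
    (x y : G) :
    expectedDiscrepancy P T ξ x y = ∫⁻ ω,
      ‖(x - updateFun T (x, ξ ω)) - (y - updateFun T (y, ξ ω))‖ₑ ^ 2 ∂P := by
  unfold expectedDiscrepancy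
  refine lintegral_congr fun ω => ?_
  rw [transportDiscrepancy_two_eq (𝕜 := 𝕜), ENNReal.ofReal_pow (norm_nonneg _), ofReal_norm]

theorem expectedDiscrepancy_self (𝕜 : Type*) [RCLike 𝕜] [InnerProductSpace 𝕜 G]
    (x : G) : expectedDiscrepancy P T ξ x x = 0 := by
  simp [expectedDiscrepancy_eq 𝕜]

variable [SecondCountableTopology G] [MeasurableSpace G] [BorelSpace G] [MeasurableSpace I]

theorem measurable_expectedDiscrepancy (𝕜 : Type*) [RCLike 𝕜] [InnerProductSpace 𝕜 G]
    [SFinite P] (hT : Measurable (updateFun T))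
    (hξ : Measurable ξ) :
    Measurable fun z : G × G => expectedDiscrepancy P T ξ z.1 z.2 := by
  simp only [expectedDiscrepancy_eq 𝕜]
  have h : Measurable fun z : (G × G) × Ω => ‖(z.1.1 - updateFun T (z.1.1, ξ z.2))
      - (z.1.2 - updateFun T (z.1.2, ξ z.2))‖ₑ ^ 2 :=
    (((measurable_fst.comp measurable_fst).sub
    (measurable_updateFun_prod hT hξ measurable_fst)).sub
    ((measurable_snd.comp measurable_fst).sub
    (measurable_updateFun_prod hT hξ measurable_snd))).enorm.pow_const 2
  exact h.lintegral_prod_right'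

variable [IsProbabilityMeasure P]

/-- `ψ₂` is the squared norm of `(x - y) - (T_ξ x - T_ξ y)`, whose two terms have `L²` norms at most
`‖x - y‖` and `r ‖x - y‖`; Minkowski adds them. -/
theorem expectedDiscrepancy_le (𝕜 : Type*) [RCLike 𝕜] [InnerProductSpace 𝕜 G]
    (hT : Measurable (updateFun T)) (hξ : Measurable ξ) {r : ℝ}
    (hr : 0 ≤ r) {x y : G}
    (h : ∫⁻ ω, edist (updateFun T (x, ξ ω)) (updateFun T (y, ξ ω)) ^ 2 ∂P
      ≤ ENNReal.ofReal (r ^ 2) * edist x y ^ 2) :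
    expectedDiscrepancy P T ξ x y ≤ ENNReal.ofReal ((1 + r) ^ 2) * edist x y ^ 2 := by
  have hm : Measurable fun ω => edist (updateFun T (x, ξ ω)) (updateFun T (y, ξ ω)) :=
    (measurable_updateFun_right hT hξ x).edist (measurable_updateFun_right hT hξ y)
  have key := lintegral_sq_le_of_le_add (μ := P) (f := fun _ => edist x y)
    (g := fun ω => edist (updateFun T (x, ξ ω)) (updateFun T (y, ξ ω)))
    (h := fun ω => ‖(x - updateFun T (x, ξ ω)) - (y - updateFun T (y, ξ ω))‖ₑ)
    aemeasurable_const hm.aemeasurable fun ω => by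
      rw [sub_sub_sub_comm, edist_eq_enorm_sub, edist_eq_enorm_sub]
      exact enorm_sub_le
  rw [← expectedDiscrepancy_eq 𝕜] at key
  have h2 : (∫⁻ ω, edist (updateFun T (x, ξ ω)) (updateFun T (y, ξ ω)) ^ 2 ∂P) ^ (1 / 2 : ℝ)
      ≤ ENNReal.ofReal r * edist x y := by
    rw [← ENNReal.pow_le_pow_left_iff two_ne_zero, rpow_half_sq, mul_pow, ← ENNReal.ofReal_pow hr]
    exact h
  have h3 : expectedDiscrepancy P T ξ x y ^ (1 / 2 : ℝ)
      ≤ ENNReal.ofReal (1 + r) * edist x y := by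
    refine key.trans ?_
    rw [ENNReal.ofReal_add zero_le_one hr, add_mul, ENNReal.ofReal_one, one_mul]
    refine add_le_add (le_of_eq ?_) h2
    rw [lintegral_const, measure_univ, mul_one, sq_rpow_half]
  rwa [← ENNReal.pow_le_pow_left_iff two_ne_zero, rpow_half_sq, mul_pow,
    ← ENNReal.ofReal_pow (by positivity)] at h3

theorem fneInExpectation_of_contraction (𝕜 : Type*) [RCLike 𝕜] [InnerProductSpace 𝕜 G]
    (hT : Measurable (updateFun T)) (hξ : Measurable ξ)
    {r : ℝ} (hr₀ : 0 ≤ r) (hr₁ : r < 1)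
    (h : ∀ x y : G, ∫⁻ ω, edist (updateFun T (x, ξ ω)) (updateFun T (y, ξ ω)) ^ 2 ∂P
      ≤ ENNReal.ofReal (r ^ 2) * edist x y ^ 2) :
    FNEInExpectation P T ξ ((1 + r) / 2) := by
  refine ⟨⟨by linarith, by linarith⟩, ⟨le_rfl, one_pos⟩, fun y x => ?_⟩
  have hr : 0 < 1 + r := by linarith
  have hq : 0 ≤ (1 - (1 + r) / 2) / ((1 + r) / 2) :=
    div_nonneg (by linarith) (by linarith)
  calc _ ≤ ENNReal.ofReal (r ^ 2) * edist x y ^ 2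
        + ENNReal.ofReal ((1 - (1 + r) / 2) / ((1 + r) / 2))
          * (ENNReal.ofReal ((1 + r) ^ 2) * edist x y ^ 2) := by
        gcongr
        · exact h x y
        · exact expectedDiscrepancy_le 𝕜 hT hξ hr₀ (h x y)
    -- With `(1 - α)/α = (1 - r)/(1 + r)`, the coefficients add up to `r² + (1 - r)(1 + r) = 1`.
    _ = _ := by
        rw [← mul_assoc, ← ENNReal.ofReal_mul hq, ← add_mul,
          ← ENNReal.ofReal_add (by positivity) (by positivity)]
        congr 2
        field_simp
        ring

/-- The pointwise inequality is integrated against `γ`; optimality of `γ` serves only to identify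
its cost with `W2 μ₁ μ₂ ^ 2`. -/
theorem FNEInExpectation.fneInMeasureOn_P2 (𝕜 : Type*) [RCLike 𝕜]
    [InnerProductSpace 𝕜 G]
    (hT : Measurable (updateFun T)) (hξ : Measurable ξ)
    {α : ℝ} (h : FNEInExpectation P T ξ α) : FNEInMeasureOn (P2 G) P T hT ξ hξ α := by
  refine ⟨h.1, h.2.1, fun μ₁ h₁ μ₂ _ γ hγ => ?_⟩
  have := h₁.1
  refine (add_le_add_left (W2_markovOp_sq_le hT hξ hγ.1) _).trans ?_
  rw [← hγ.2, ← lintegral_const_mul _ (measurable_expectedDiscrepancy 𝕜 hT hξ),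
    ← lintegral_const_mul _ measurable_edist_sq,
    ← lintegral_add_right _ ((measurable_expectedDiscrepancy 𝕜 hT hξ).const_mul _)]
  exact lintegral_mono fun z => h.2.2 z.2 z.1

/-- The diagonal coupling of `π` with itself is optimal, and `ψ₂` vanishes on it. -/
theorem markovTransportDiscrepancy_eq_zero (𝕜 : Type*) [RCLike 𝕜] [InnerProductSpace 𝕜 G]
    (hT : Measurable (updateFun T)) (hξ : Measurable ξ)
    {π : Measure G} (hπ : π ∈ invMeasures (transitionKernel P T hT ξ hξ)) :
    markovTransportDiscrepancy P T hT ξ hξ π = 0 := by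
  refine nonpos_iff_eq_zero.1
    ((iInf₂_le_of_le π hπ (iInf₂_le _ (map_diag_mem_optimalCouplings π))).trans_eq ?_)
  rw [lintegral_map (measurable_expectedDiscrepancy 𝕜 hT hξ) (by fun_prop)]
  simp [expectedDiscrepancy_self 𝕜]

end Discrepancy

/-- Absorption of `r a` into the left side, which in `[0, ∞]` requires `a` to be finite. -/
theorem le_ofReal_inv_mul_of_le_add {a b c : ℝ≥0∞} {q r : ℝ} (hq : 0 < q) (hr₀ : 0 ≤ r)
    (hr₁ : r < 1) (ha : a ≠ ∞) (hab : a ≤ b + ENNReal.ofReal r * a)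
    (hbc : ENNReal.ofReal q * b ≤ c) : a ≤ ENNReal.ofReal (q * (1 - r))⁻¹ * c := by
  have h1 : 0 < 1 - r := by linarith
  rw [ENNReal.ofReal_inv_of_pos (by positivity), mul_comm, ← div_eq_mul_inv,
    ENNReal.le_div_iff_mul_le (by simp; left; positivity) (by simp),
    ENNReal.ofReal_mul hq.le, ENNReal.ofReal_sub _ hr₀, ENNReal.ofReal_one]
  refine le_trans ?_ hbc
  rw [mul_left_comm]
  gcongr
  rw [mul_comm, ENNReal.sub_mul (fun _ _ => ha), one_mul]
  exact tsub_le_iff_right.2 hab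

theorem absDiff_zero_left (a : ℝ≥0∞) : absDiff 0 a = a := by simp [absDiff]

end RandomFunctionIteration

/-! ### The main theorem. -/

open RandomFunctionIteration
theorem theorem2p11 {𝕜 G I Ω : Type*} [RCLike 𝕜]
    [NormedAddCommGroup G] [InnerProductSpace 𝕜 G] [CompleteSpace G]
    [TopologicalSpace.SeparableSpace G] [MeasurableSpace G] [BorelSpace G]
    [MeasurableSpace I] [MeasurableSpace Ω]
    (P : Measure Ω) [IsProbabilityMeasure P] (ξ : Ω → I) (hξ : Measurable ξ)
    (T : I → G → G) (hT : Measurable (updateFun T))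
    (r : ℝ) (hr₀ : 0 ≤ r) (hr₁ : r < 1)
    (hcontr : ContractionInExpectation P T ξ r)
    (hmoment : ∃ y : G, ∫⁻ ω, ‖updateFun T (y, ξ ω) - y‖ₑ ^ 2 ∂P < ∞) :
    (∃ π ∈ invMeasures (transitionKernel P T hT ξ hξ) ∩ P2 G,
    (∀ π' ∈ invMeasures (transitionKernel P T hT ξ hξ) ∩ P2 G, π' = π) ∧
      ∀ μ₀ ∈ P2 G,
    (∀ n : ℕ, W2 ((markovOp (transitionKernel P T hT ξ hξ))^[n] μ₀) π
          ≤ ENNReal.ofReal r ^ n * W2 μ₀ π) ∧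
        QLinearConvergence W2
    (fun k => (markovOp (transitionKernel P T hT ξ hξ))^[k] μ₀) π r) ∧
    (FNEInExpectation P T ξ ((1 + r) / 2) ∧
      FNEInMeasureOn (P2 G) P T hT ξ hξ ((1 + r) / 2)) ∧
    (∀ q : ℝ, 0 < q →
    (∀ μ ∈ P2 G, ENNReal.ofReal q * W2 (markovOp (transitionKernel P T hT ξ hξ) μ) μ
        ≤ markovTransportDiscrepancy P T hT ξ hξ μ) →
      LinearlyMetricallySubregular W2 absDiff (markovTransportDiscrepancy P T hT ξ hξ)
        0 (P2 G) (P2 G) (q * (1 - r))⁻¹) := by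
  have : SecondCountableTopology G := UniformSpace.secondCountable_of_separable G
  have h : ∀ x y : G, ∫⁻ ω, edist (updateFun T (x, ξ ω)) (updateFun T (y, ξ ω)) ^ 2 ∂P
      ≤ ENNReal.ofReal (r ^ 2) * edist x y ^ 2 := by
    simpa only [ContractionInExpectation, ← edist_eq_enorm_sub] using hcontr
  obtain ⟨y, hy⟩ := hmoment
  simp only [← edist_eq_enorm_sub, edist_comm _ y] at hy
  obtain ⟨π, hπ, hπ₂⟩ := exists_invariant_measure hT hξ hr₀ hr₁ h y hy
  have := hπ.1
  set p := transitionKernel P T hT ξ hξ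
  have hstep : ∀ μ : Measure G, IsProbabilityMeasure μ →
      W2 (markovOp p μ) π ≤ ENNReal.ofReal r * W2 μ π := fun μ _ => by
    conv_lhs => rw [← hπ.2]
    exact W2_markovOp_le hT hξ hr₀ h
  have hfne := fneInExpectation_of_contraction 𝕜 hT hξ hr₀ hr₁ h
  refine ⟨⟨π, ⟨hπ, hπ₂⟩, fun π' hπ' => ?_, fun μ₀ hμ₀ => ?_⟩,
    ⟨hfne, hfne.fneInMeasureOn_P2 𝕜 hT hξ⟩, fun q hq hΨ => ⟨?_, fun μ hμ => ?_⟩⟩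
  · have := hπ'.1.1
    have hle := hstep π' hπ'.1.1
    rw [hπ'.1.2] at hle
    -- Both measures being invariant, `W2 π' π ≤ r W2 π' π`; a nonzero finite distance would
    -- contradict `r < 1`.
    refine eq_of_W2_eq_zero (by_contra fun hne => absurd hle (not_le.2 ?_))
    calc _ < 1 * W2 π' π := ENNReal.mul_lt_mul_left hne (W2_lt_top hπ'.2 hπ₂).ne (by simpa using hr₁)
      _ = _ := one_mul _
  · have := hμ₀.1
    have hprob : ∀ n, IsProbabilityMeasure ((markovOp p)^[n] μ₀) := fun n => by
      induction n with
      | zero => exact hμ₀.1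
      | succ n ih =>
        rw [Function.iterate_succ_apply']
        exact isProbabilityMeasure_markovOp p _
    have hq : ∀ k, W2 ((markovOp p)^[k + 1] μ₀) π
        ≤ ENNReal.ofReal r * W2 ((markovOp p)^[k] μ₀) π := fun k => by
      rw [Function.iterate_succ_apply']
      exact hstep _ (hprob k)
    refine ⟨fun n => ?_, ⟨hr₀, hr₁⟩, hq⟩
    induction n with
    | zero => simp
    | succ n ih =>
      rw [pow_succ', mul_assoc]
      exact (hq n).trans (by gcongr)
  · have : 0 < 1 - r := by linarith
    positivity
  · have := hμ.2.1
    have := isProbabilityMeasure_markovOp p μ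
    -- The invariant `π` is a zero of `Ψ` in `P2 G`, so it suffices to bound the distance to it.
    refine (iInf₂_le π ⟨markovTransportDiscrepancy_eq_zero 𝕜 hT hξ hπ, hπ₂⟩).trans ?_
    rw [absDiff_zero_left]
    refine le_ofReal_inv_mul_of_le_add hq hr₀ hr₁ (W2_lt_top hμ.2 hπ₂).ne ?_ (hΨ μ hμ.2)
    refine (W2_triangle (ν := markovOp p μ)).trans (add_le_add ?_ (hstep μ hμ.2.1))
    exact (W2_comm _ _).le
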